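/- Let $1<p<n$ be integers, $r>0$ and $M,K\ge 0$. There is a constant $C$ depending only on $n,p,r,M,K$ with the following property. For a symmetric real $n\times n$ matrix $A$ with eigenvalues $\lambda_1,\dots,\lambda_n$ (counted with multiplicity) put $$\mathcal M_p(A)=\prod_{1\le i_1<\dots<i_p\le n}(\lambda_{i_1}+\dots+\lambda_{i_p}),$$ and let $P_p$ be the cone of those symmetric $A$ for which all the sums $\lambda_{i_1}+\dots+\lambda_{i_p}$ ($i_1<\dots<i_p$) are positive. A $C^2$ function $u$ on a domain $\Omega\subset\mathbb R^n$ is called $p$-plurisubharmonic if $D^2u(x)\in\overline{P_p}$ for every $x\in\Omega$; write $\mathcal M_p(u)(x)=\mathcal M_p(D^2u(x))$. Let $x_0\in\mathbb R^n$ and let $u\in C^3(B_r(x_0))\cap C^1(\overline{B_r(x_0)})$ be $p$-plurisubharmonic in $B_r(x_0)$ with $\sup_{B_r(x_0)}|u|\le M$. Suppose that $u$ solves $$\mathcal M_p(u)(x)=f(x,u(x))\qquad\text{in } B_r(x_0),$$ where $f\ge 0$ on $B_r(x_0)\times\mathbb R$ has Lipschitz bound $K$, that is, $|f(x,s)|\le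 K$ and $|f(x,s)-f(y,t)|\le K(|x-y|+|s-t|)$ for all $x,y\in B_r(x_0)$ and $s,t\in\mathbb R$. Then $$|Du(x_0)|\le C .$$ -/

import Mathlib

/-- The Hessian matrix `D²u(x)` of a function `u` on `ℝⁿ`: its `(i, j)` entry is the second
derivative of `u` at `x` in the coordinate directions `i` and `j`. -/
noncomputable def hessian {n : ℕ} (u : EuclideanSpace ℝ (Fin n) → ℝ)
    (x : EuclideanSpace ℝ (Fin n)) : Matrix (Fin n) (Fin n) ℝ :=
  Matrix.of fun i j =>
    fderiv ℝ (fderiv ℝ u) x (EuclideanSpace.single i 1) (EuclideanSpace.single j 1)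

/-- The Hessian of a `C²` function on an open set is symmetric. -/
theorem hessian_isHermitian {n : ℕ} {u : EuclideanSpace ℝ (Fin n) → ℝ}
    {Ω : Set (EuclideanSpace ℝ (Fin n))} (hΩ : IsOpen Ω) (hu : ContDiffOn ℝ 2 u Ω)
    {x : EuclideanSpace ℝ (Fin n)} (hx : x ∈ Ω) : (hessian u x).IsHermitian := by
  have h : IsSymmSndFDerivAt ℝ u x :=
    (hu.contDiffAt (hΩ.mem_nhds hx)).isSymmSndFDerivAt (by simp)
  ext i j
  simpa [hessian] using h (EuclideanSpace.single j 1) (EuclideanSpace.single i 1)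

/-- The cone `P_p` of symmetric `n × n` matrices all of whose sums of `p` eigenvalues
(eigenvalues listed with multiplicity, `p` different indices) are positive. -/
def pCone (n p : ℕ) : Set (Matrix (Fin n) (Fin n) ℝ) :=
  {A | ∃ hA : A.IsHermitian,
    ∀ s ∈ (Finset.univ : Finset (Fin n)).powersetCard p, 0 < ∑ i ∈ s, hA.eigenvalues i}

/-- A function `u` is `p`-plurisubharmonic on a domain `Ω ⊆ ℝⁿ` if it is `C²` there and its
Hessian lies at every point of `Ω` in the closure of the cone `P_p`. -/
structure IsPPlurisubharmonicOn {n : ℕ} (p : ℕ) (u : EuclideanSpace ℝ (Fin n) → ℝ)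
    (Ω : Set (EuclideanSpace ℝ (Fin n))) : Prop where
  contDiffOn : ContDiffOn ℝ 2 u Ω
  hessian_mem : ∀ x ∈ Ω, hessian u x ∈ closure (pCone n p)

open Classical in
/-- The product of all sums `λ_{i₁} + ⋯ + λ_{i_p}`, `i₁ < ⋯ < i_p`, of eigenvalues of a symmetric
matrix `A` (with the irrelevant value `0` if `A` is not symmetric). -/
noncomputable def mpMatrix {n : ℕ} (p : ℕ) (A : Matrix (Fin n) (Fin n) ℝ) : ℝ :=
  if hA : A.IsHermitian then
    ∏ s ∈ (Finset.univ : Finset (Fin n)).powersetCard p, ∑ i ∈ s, hA.eigenvalues i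
  else 0

/-- The operator `𝓜_p(u)` at the point `x`. -/
noncomputable def mpOperator {n : ℕ} (p : ℕ) (u : EuclideanSpace ℝ (Fin n) → ℝ)
    (x : EuclideanSpace ℝ (Fin n)) : ℝ :=
  mpMatrix p (hessian u x)

/-- `f = f(x, s)` has Lipschitz bound `K` on `Ω × ℝ`: it is bounded by `K` and Lipschitz with
constant `K` there. -/
structure HasLipschitzBound {n : ℕ} (f : EuclideanSpace ℝ (Fin n) → ℝ → ℝ)
    (Ω : Set (EuclideanSpace ℝ (Fin n))) (K : ℝ) : Prop where
  bound : ∀ x ∈ Ω, ∀ s : ℝ, |f x s| ≤ K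
  lipschitz : ∀ x ∈ Ω, ∀ y ∈ Ω, ∀ s t : ℝ, |f x s - f y t| ≤ K * (‖x - y‖ + |s - t|)

open scoped RealInnerProductSpace
open Filter Topology

/-! Put w = -log(c - u) with c = M + 1, so that D²w = D²u/(c - u) + Dw ⊗ Dw. It suffices to show
w(x₀) - w(y) ≤ L|x₀ - y| for y near x₀. To this end w(x) - w(y) - g(|x - y|) - B|x - x₀|² is
maximized, where g is concave with slope q between L/2 and L and -g'' = F of order L². A positive
maximum is interior; there Dw(y) = q e and Dw(x) = q e + b, with e the unit vector along x - y and
|b| ≤ Br, and the Hessians of w are comparable along pairs (ξ, η) with ξ - η parallel to e.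

From D²u(x) in the closed cone, every p-sum of eigenvalues of D²u(y) is bounded below
(`partial_trace_lower_bound`). If the span of the p eigenvectors carries enough of e, reflecting
them in the hyperplane e^⊥ gains a multiple of F. Otherwise half of the direction e can be added to
the trace at x, and the pair (e, 0) gains about q²/2 from Dw ⊗ Dw. Both gains are quadratic in L,
the errors from b and B at most linear. So for large L, 𝓜_p(u)(y) > K
(`lt_mpOperator_of_isLocalMax`), against f ≤ K; hence no positive maximum exists
(`doubling_nonpos`). -/

/-! ### Quadratic forms and the closed cone -/

/-- The quadratic form `ξ ↦ ⟨A ξ, ξ⟩` of a real matrix. -/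
noncomputable def quadForm {n : ℕ} (A : Matrix (Fin n) (Fin n) ℝ)
    (ξ : EuclideanSpace ℝ (Fin n)) : ℝ :=
  ⟪Matrix.toEuclideanLin A ξ, ξ⟫

theorem quadForm_eq_sum {n : ℕ} (A : Matrix (Fin n) (Fin n) ℝ)
    (ξ : EuclideanSpace ℝ (Fin n)) :
    quadForm A ξ = ∑ i, ∑ j, ξ i * ξ j * A i j := by
  simp only [quadForm, Matrix.toLpLin_apply, PiLp.inner_apply, Matrix.mulVec, dotProduct,
    RCLike.inner_apply, conj_trivial, Finset.mul_sum]
  exact Finset.sum_congr rfl fun i _ => Finset.sum_congr rfl fun j _ => by ring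

theorem continuous_quadForm {n : ℕ} (ξ : EuclideanSpace ℝ (Fin n)) :
    Continuous fun A : Matrix (Fin n) (Fin n) ℝ => quadForm A ξ := by
  simp only [quadForm_eq_sum]
  fun_prop

theorem toEuclideanLin_eigenvectorBasis {n : ℕ} {A : Matrix (Fin n) (Fin n) ℝ}
    (hA : A.IsHermitian) (i : Fin n) :
    Matrix.toEuclideanLin A (hA.eigenvectorBasis i)
      = hA.eigenvalues i • hA.eigenvectorBasis i := by
  ext j
  simpa [Matrix.toLpLin_apply] using congrFun (hA.mulVec_eigenvectorBasis i) j

theorem quadForm_eigenvectorBasis {n : ℕ} {A : Matrix (Fin n) (Fin n) ℝ}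
    (hA : A.IsHermitian) (i : Fin n) :
    quadForm A (hA.eigenvectorBasis i) = hA.eigenvalues i := by
  rw [quadForm, toEuclideanLin_eigenvectorBasis, real_inner_smul_left,
    real_inner_self_eq_norm_sq, hA.eigenvectorBasis.orthonormal.1 i]
  simp

theorem quadForm_eq_sum_eigenvalues {n : ℕ} {A : Matrix (Fin n) (Fin n) ℝ}
    (hA : A.IsHermitian) (ξ : EuclideanSpace ℝ (Fin n)) :
    quadForm A ξ = ∑ j, hA.eigenvalues j * ⟪ξ, hA.eigenvectorBasis j⟫ ^ 2 := by
  rw [quadForm, ← hA.eigenvectorBasis.sum_inner_mul_inner]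
  refine Finset.sum_congr rfl fun j _ => ?_
  rw [Matrix.isSymmetric_toEuclideanLin_iff.mpr hA ξ, toEuclideanLin_eigenvectorBasis,
    real_inner_smul_right, real_inner_comm ξ]
  ring

/-- If all sums of `p` of the numbers `l i` are nonnegative, so are the weighted sums with weights
in `[0, θ]` of total mass `p θ`. -/
theorem weighted_sum_nonneg {n p : ℕ} (hp : 0 < p) (hpn : p ≤ n) (l c : Fin n → ℝ) {θ : ℝ}
    (hl : ∀ s ∈ (Finset.univ : Finset (Fin n)).powersetCard p, 0 ≤ ∑ i ∈ s, l i)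
    (hc0 : ∀ i, 0 ≤ c i) (hc1 : ∀ i, c i ≤ θ) (hc : ∑ i, c i = p * θ) :
    0 ≤ ∑ i, c i * l i := by
  classical
  have hne : ((Finset.univ : Finset (Fin n)).powersetCard p).Nonempty :=
    Finset.powersetCard_nonempty.2 (by simpa using hpn)
  obtain ⟨s, hs, hmin⟩ := Finset.exists_min_image _ (fun s => ∑ i ∈ s, l i) hne
  have hcard : s.card = p := (Finset.mem_powersetCard.1 hs).2
  have hsne : s.Nonempty := Finset.card_pos.1 (hcard ▸ hp)
  obtain ⟨k, hk, hmax⟩ := Finset.exists_max_image s l hsne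
  -- Exchanging k for j cannot lower the minimal sum.
  have hout : ∀ j ∉ s, l k ≤ l j := by
    intro j hj
    have hj' : j ∉ s.erase k := fun h => hj (Finset.mem_of_mem_erase h)
    have hmem : insert j (s.erase k) ∈ (Finset.univ : Finset (Fin n)).powersetCard p := by
      rw [Finset.mem_powersetCard]
      refine ⟨Finset.subset_univ _, ?_⟩
      rw [Finset.card_insert_of_notMem hj', Finset.card_erase_of_mem hk, hcard]
      omega
    have h1 := hmin _ hmem
    rw [Finset.sum_insert hj', ← Finset.add_sum_erase s l hk] at h1
    linarith
  have hθ : 0 ≤ θ := (hc0 k).trans (hc1 k)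
  have h2 : ∑ i ∈ s, θ * (l i - l k) ≤ ∑ i, c i * (l i - l k) := by
    rw [← Finset.sum_add_sum_compl s fun i => c i * (l i - l k)]
    have h3 : ∑ i ∈ s, θ * (l i - l k) ≤ ∑ i ∈ s, c i * (l i - l k) :=
      Finset.sum_le_sum fun i hi =>
        mul_le_mul_of_nonpos_right (hc1 i) (sub_nonpos.2 (hmax i hi))
    have h4 : 0 ≤ ∑ i ∈ sᶜ, c i * (l i - l k) :=
      Finset.sum_nonneg fun i hi =>
        mul_nonneg (hc0 i) (sub_nonneg.2 (hout i (Finset.mem_compl.1 hi)))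
    linarith
  have h5 : ∑ i, c i * (l i - l k) = ∑ i, c i * l i - p * θ * l k := by
    rw [← hc, Finset.sum_mul, ← Finset.sum_sub_distrib]
    exact Finset.sum_congr rfl fun i _ => by ring
  have h6 : ∑ i ∈ s, θ * (l i - l k) = θ * ∑ i ∈ s, l i - p * θ * l k := by
    rw [Finset.mul_sum, ← hcard]
    simp only [mul_sub, Finset.sum_sub_distrib, Finset.sum_const, nsmul_eq_mul]
    ring
  have h7 := mul_nonneg hθ (hl s hs)
  linarith

/-- The condition is closed in A, so A may be taken in the open cone. In an eigenbasis of A the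
expression is a weighted sum of eigenvalues; `hle` puts the weights in [0, θ] and `htr` makes their
total p θ. -/
theorem quadForm_sum_nonneg {n p : ℕ} (hp : 0 < p) (hpn : p ≤ n)
    {A : Matrix (Fin n) (Fin n) ℝ} (hA : A ∈ closure (pCone n p)) (s : Finset (Fin n))
    (ξ : Fin n → EuclideanSpace ℝ (Fin n)) (e : EuclideanSpace ℝ (Fin n)) {κ θ : ℝ}
    (hκ : 0 ≤ κ)
    (hle : ∀ z, ∑ i ∈ s, ⟪ξ i, z⟫ ^ 2 + κ * ⟪e, z⟫ ^ 2 ≤ θ * ‖z‖ ^ 2)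
    (htr : ∑ i ∈ s, ‖ξ i‖ ^ 2 + κ * ‖e‖ ^ 2 = p * θ) :
    0 ≤ ∑ i ∈ s, quadForm A (ξ i) + κ * quadForm A e := by
  have hcl : IsClosed {A : Matrix (Fin n) (Fin n) ℝ |
      0 ≤ ∑ i ∈ s, quadForm A (ξ i) + κ * quadForm A e} := by
    refine isClosed_le continuous_const ?_
    exact (continuous_finsetSum _ fun i _ => continuous_quadForm _).add
      (continuous_const.mul (continuous_quadForm _))
  refine closure_minimal ?_ hcl hA
  rintro A ⟨hH, hpos⟩
  simp only [Set.mem_ofPred_eq, quadForm_eq_sum_eigenvalues hH]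
  set v := hH.eigenvectorBasis with hv
  have hnorm : ∀ z : EuclideanSpace ℝ (Fin n), ∑ j, ⟪z, v j⟫ ^ 2 = ‖z‖ ^ 2 := fun z => by
    simpa using v.sum_sq_norm_inner_left z
  have key := weighted_sum_nonneg hp hpn hH.eigenvalues
    (fun j => ∑ i ∈ s, ⟪ξ i, v j⟫ ^ 2 + κ * ⟪e, v j⟫ ^ 2) (θ := θ)
    (fun t ht => (hpos t ht).le) (fun j => by positivity)
    (fun j => by simpa [v.orthonormal.1 j] using hle (v j))
    (by
      rw [← htr, Finset.sum_add_distrib, Finset.sum_comm, ← Finset.mul_sum, hnorm]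
      simp only [hnorm])
  refine key.trans_eq ?_
  rw [Finset.sum_comm, Finset.mul_sum, ← Finset.sum_add_distrib]
  refine Finset.sum_congr rfl fun j _ => ?_
  rw [add_mul, Finset.sum_mul]
  congr 1
  · exact Finset.sum_congr rfl fun i _ => by ring
  · ring

/-! ### Partial traces at the two points -/

/-- Lower bound for a partial trace of a form `Y` that is compared with a matrix `A` in the
closed cone along pairs of vectors whose difference is parallel to the unit vector `e`. -/
theorem partial_trace_lower_bound {n p : ℕ} (hp : 0 < p) (hpn : p ≤ n)
    {A : Matrix (Fin n) (Fin n) ℝ} (hA : A ∈ closure (pCone n p)) {c : ℝ} (hc : 0 < c)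
    (v : OrthonormalBasis (Fin n) ℝ (EuclideanSpace ℝ (Fin n))) (Y : Fin n → ℝ)
    {s : Finset (Fin n)} (hs : s.card = p)
    {e b : EuclideanSpace ℝ (Fin n)} (he : ‖e‖ = 1) {q F B β : ℝ} (hq : 0 ≤ q)
    (hF : 0 ≤ F) (hb : ‖b‖ ≤ β)
    (h1 : quadForm A e / c + (q + ⟪b, e⟫) ^ 2 + F - 2 * B ≤ 0)
    (h2 : ∀ i, quadForm A (v i) / c + (q * ⟪e, v i⟫ + ⟪b, v i⟫) ^ 2 - Y i
      - (q * ⟪e, v i⟫) ^ 2 - 2 * B ≤ 0)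
    (h3 : ∀ i, quadForm A (v i - (2 * ⟪e, v i⟫) • e) / c
      + (-(q * ⟪e, v i⟫) + ⟪b, v i - (2 * ⟪e, v i⟫) • e⟫) ^ 2 - Y i - (q * ⟪e, v i⟫) ^ 2
      + 4 * F * ⟪e, v i⟫ ^ 2 - 2 * B ≤ 0) :
    min (2 * F / p) (q ^ 2 / 2 - q * β - B) - 2 * p * (q * β + B) ≤ ∑ i ∈ s, Y i := by
  have hp' : (0 : ℝ) < p := by exact_mod_cast hp
  have hβ : 0 ≤ β := (norm_nonneg b).trans hb
  have hα : ∀ i, |⟪e, v i⟫| ≤ 1 := fun i => by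
    simpa [he, v.orthonormal.1 i] using abs_real_inner_le_norm e (v i)
  have hbu : ∀ z : EuclideanSpace ℝ (Fin n), ‖z‖ = 1 → |⟪b, z⟫| ≤ β := fun z hz => by
    have := abs_real_inner_le_norm b z
    rw [hz, mul_one] at this
    exact this.trans hb
  have hprod : ∀ (i) (z : EuclideanSpace ℝ (Fin n)), ‖z‖ = 1 →
      |q * ⟪e, v i⟫ * ⟪b, z⟫| ≤ q * β := fun i z hz => by
    rw [abs_mul, abs_mul, abs_of_nonneg hq, mul_assoc]
    refine mul_le_mul_of_nonneg_left ?_ hq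
    simpa using mul_le_mul (hα i) (hbu z hz) (abs_nonneg _) zero_le_one
  have hnorm : ∀ z : EuclideanSpace ℝ (Fin n), ∑ j, ⟪v j, z⟫ ^ 2 = ‖z‖ ^ 2 := fun z => by
    simpa using v.sum_sq_norm_inner_right z
  have hcard : ∀ x : ℝ, ∑ _i ∈ s, x = p * x := fun x => by simp [hs]
  have hsub : ∀ z : EuclideanSpace ℝ (Fin n), ∑ j ∈ s, ⟪v j, z⟫ ^ 2 ≤ ‖z‖ ^ 2 := fun z => by
    rw [← hnorm z]
    exact Finset.sum_le_sum_of_subset_of_nonneg (Finset.subset_univ s) fun _ _ _ => sq_nonneg _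
  set a := ∑ i ∈ s, ⟪e, v i⟫ ^ 2 with ha
  -- Here a is the squared length of the projection of e to the span of the chosen vectors. If it is
  -- at least 1/(2p), the reflected pairs `h3` are used; otherwise the equal pairs `h2` plus half of
  -- `h1`.
  rcases le_or_gt (1 / (2 * p) : ℝ) a with hcase | hcase
  · set ξ : Fin n → EuclideanSpace ℝ (Fin n) := fun i => v i - (2 * ⟪e, v i⟫) • e with hξ
    have hξz : ∀ i z, ⟪ξ i, z⟫ = ⟪v i, z - (2 * ⟪e, z⟫) • e⟫ := fun i z => by
      simp only [hξ, inner_sub_left, inner_sub_right, real_inner_smul_left,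
        real_inner_smul_right, real_inner_comm e (v i)]
      ring
    have hrefl : ∀ z : EuclideanSpace ℝ (Fin n), ‖z - (2 * ⟪e, z⟫) • e‖ ^ 2 = ‖z‖ ^ 2 :=
      fun z => by
        rw [norm_sub_sq_real, real_inner_smul_right, norm_smul, he, real_inner_comm]
        simp only [Real.norm_eq_abs, mul_one, sq_abs]
        ring
    have hξ1 : ∀ i, ‖ξ i‖ = 1 := fun i => by
      have := hrefl (v i)
      rw [v.orthonormal.1 i, one_pow] at this
      exact (pow_eq_one_iff_of_nonneg (norm_nonneg _) two_ne_zero).1 this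
    have hX := quadForm_sum_nonneg hp hpn hA s ξ 0 (κ := 0) (θ := 1) le_rfl
      (fun z => by
        simp only [hξz, zero_mul, add_zero, one_mul]
        exact (hsub _).trans_eq (hrefl z))
      (by simp [hξ1, hs])
    simp only [zero_mul, add_zero] at hX
    have hi : ∀ i ∈ s, quadForm A (ξ i) / c + 4 * F * ⟪e, v i⟫ ^ 2 - 2 * (q * β + B) ≤ Y i := by
      intro i _
      have := h3 i
      have h4 := abs_le.1 (hprod i (ξ i) (hξ1 i))
      nlinarith [sq_nonneg ⟪b, ξ i⟫]
    have hsum := Finset.sum_le_sum hi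
    rw [Finset.sum_sub_distrib, Finset.sum_add_distrib, hcard, ← Finset.mul_sum,
      ← Finset.sum_div, ← ha] at hsum
    have h5 : 0 ≤ (∑ i ∈ s, quadForm A (ξ i)) / c := div_nonneg hX hc.le
    have h6 : 2 * F / p ≤ 4 * F * a := by
      have := mul_le_mul_of_nonneg_left hcase (by positivity : 0 ≤ 4 * F)
      refine le_trans (le_of_eq ?_) this
      field_simp
      ring
    have h7 := min_le_left (2 * F / p) (q ^ 2 / 2 - q * β - B)
    linarith
  -- The trace is p + 1/2 = p θ. The upper bound θ follows from ⟪e, z⟫²/2 ≤ x² + y² ≤ a S + T, with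
  -- x, S from indices in s and y, T from the others, since a < 1/(2p).
  · have hX := quadForm_sum_nonneg hp hpn hA s v e (κ := 1 / 2) (θ := 1 + 1 / (2 * p))
      (by norm_num)
      (fun z => by
        have hez : ⟪e, z⟫ = ∑ i ∈ s, ⟪e, v i⟫ * ⟪v i, z⟫ + ∑ i ∈ sᶜ, ⟪e, v i⟫ * ⟪v i, z⟫ := by
          rw [Finset.sum_add_sum_compl, v.sum_inner_mul_inner]
        have hz := hnorm z
        rw [← Finset.sum_add_sum_compl s] at hz
        have hone : ∑ i ∈ sᶜ, ⟪e, v i⟫ ^ 2 ≤ 1 := by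
          have := hnorm e
          simp only [real_inner_comm e, he, one_pow] at this
          rw [← this]
          exact Finset.sum_le_sum_of_subset_of_nonneg (Finset.subset_univ _)
            fun _ _ _ => sq_nonneg _
        have c1 := Finset.sum_mul_sq_le_sq_mul_sq s (fun i => ⟪e, v i⟫) fun i => ⟪v i, z⟫
        have c2 := Finset.sum_mul_sq_le_sq_mul_sq sᶜ (fun i => ⟪e, v i⟫) fun i => ⟪v i, z⟫
        rw [← ha] at c1
        rw [hez, ← hz]
        set S := ∑ i ∈ s, ⟪v i, z⟫ ^ 2
        set T := ∑ i ∈ sᶜ, ⟪v i, z⟫ ^ 2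
        set x := ∑ i ∈ s, ⟪e, v i⟫ * ⟪v i, z⟫
        set y := ∑ i ∈ sᶜ, ⟪e, v i⟫ * ⟪v i, z⟫
        have hS : 0 ≤ S := Finset.sum_nonneg fun _ _ => sq_nonneg _
        have hT : 0 ≤ T := Finset.sum_nonneg fun _ _ => sq_nonneg _
        have c3 : a * S ≤ 1 / (2 * p) * S := mul_le_mul_of_nonneg_right hcase.le hS
        have c4 : (∑ i ∈ sᶜ, ⟪e, v i⟫ ^ 2) * T ≤ 1 * T := mul_le_mul_of_nonneg_right hone hT
        have c5 : 0 ≤ 1 / (2 * (p : ℝ)) * T := by positivity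
        nlinarith [sq_nonneg (x - y)])
      (by
        simp only [v.orthonormal.1, he, one_pow, hcard]
        field_simp)
    have hi : ∀ i ∈ s, quadForm A (v i) / c - 2 * (q * β + B) ≤ Y i := by
      intro i _
      have := h2 i
      have h4 := abs_le.1 (hprod i (v i) (v.orthonormal.1 i))
      nlinarith [sq_nonneg ⟪b, v i⟫]
    have hsum := Finset.sum_le_sum hi
    rw [Finset.sum_sub_distrib, hcard, ← Finset.sum_div] at hsum
    have h5 : 0 ≤ (∑ i ∈ s, quadForm A (v i)) / c + quadForm A e / c / 2 := by
      have := div_nonneg hX hc.le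
      rw [add_div] at this
      refine this.trans_eq ?_
      ring
    have h6 : q ^ 2 - 2 * (q * β) ≤ (q + ⟪b, e⟫) ^ 2 := by
      have := (abs_le.1 (hbu e he)).1
      nlinarith [sq_nonneg ⟪b, e⟫]
    have h7 := min_le_right (2 * F / p) (q ^ 2 / 2 - q * β - B)
    linarith

/-! ### Derivatives along lines -/

/-- Second derivative test: at a local maximum the second derivative is nonpositive. -/
theorem IsLocalMax.second_deriv_nonpos {f f' : ℝ → ℝ} {a c : ℝ} (h : IsLocalMax f a)
    (hf : ∀ᶠ s in 𝓝 a, HasDerivAt f (f' s) s) (hf' : HasDerivAt f' c a) : c ≤ 0 := by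
  by_contra! hc
  have hderiv : deriv f =ᶠ[𝓝 a] f' := hf.mono fun s hs => hs.deriv
  have h2 : deriv (deriv f) a = c := hderiv.deriv_eq.trans hf'.deriv
  -- A positive second derivative would give a local minimum too, making f locally constant.
  have hmin := isLocalMin_of_deriv_deriv_pos (h2 ▸ hc) h.deriv_eq_zero
    hf.self_of_nhds.continuousAt
  have hconst : f =ᶠ[𝓝 a] fun _ => f a := by
    filter_upwards [h, hmin] with s hs hs' using le_antisymm hs hs'
  have h0 : deriv (deriv f) a = 0 := by
    rw [hconst.deriv.deriv_eq]
    simp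
  linarith

section Lines

variable {E : Type*} [NormedAddCommGroup E] [InnerProductSpace ℝ E]

theorem hasDerivAt_line (z ξ : E) (s : ℝ) : HasDerivAt (fun s : ℝ => z + s • ξ) ξ s := by
  simpa using ((hasDerivAt_id s).smul_const ξ).const_add z

theorem tendsto_line (z ξ : E) : Tendsto (fun s : ℝ => z + s • ξ) (𝓝 0) (𝓝 z) := by
  simpa using (hasDerivAt_line z ξ 0).continuousAt.tendsto

theorem ContDiffAt.eventually_hasDerivAt_line {u : E → ℝ} {z : E} (hu : ContDiffAt ℝ 2 u z)
    (ξ : E) : ∀ᶠ s in 𝓝 (0 : ℝ),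
      HasDerivAt (fun s : ℝ => u (z + s • ξ)) (fderiv ℝ u (z + s • ξ) ξ) s := by
  have h := (tendsto_line z ξ).eventually (hu.eventually (by simp))
  filter_upwards [h] with s hs
  exact (hs.differentiableAt (by simp)).hasFDerivAt.comp_hasDerivAt s (hasDerivAt_line z ξ s)

theorem ContDiffAt.hasDerivAt_fderiv_line {u : E → ℝ} {z : E} (hu : ContDiffAt ℝ 2 u z)
    (ξ : E) : HasDerivAt (fun s : ℝ => fderiv ℝ u (z + s • ξ) ξ)
      (fderiv ℝ (fderiv ℝ u) z ξ ξ) 0 := by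
  have hd : DifferentiableAt ℝ (fderiv ℝ u) z :=
    (hu.fderiv_right (m := 1) (by norm_num)).differentiableAt (by simp)
  have hl := hasDerivAt_line z ξ 0
  have h1 : HasFDerivAt (fderiv ℝ u) (fderiv ℝ (fderiv ℝ u) z) (z + (0 : ℝ) • ξ) := by
    simpa using hd.hasFDerivAt
  have h2 : HasDerivAt (fun s : ℝ => fderiv ℝ u (z + s • ξ)) (fderiv ℝ (fderiv ℝ u) z ξ) 0 :=
    h1.comp_hasDerivAt 0 hl
  simpa using h2.clm_apply (hasDerivAt_const (0 : ℝ) ξ)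

/-- The derivative of `-log (c - u)` at `z` in the direction `ξ`. -/
noncomputable def dlog (u : E → ℝ) (c : ℝ) (z ξ : E) : ℝ :=
  fderiv ℝ u z ξ / (c - u z)

theorem ContDiffAt.eventually_hasDerivAt_log_line {u : E → ℝ} {z : E} {c : ℝ}
    (hu : ContDiffAt ℝ 2 u z) (hc : u z < c) (ξ : E) : ∀ᶠ s in 𝓝 (0 : ℝ),
      HasDerivAt (fun s : ℝ => -Real.log (c - u (z + s • ξ))) (dlog u c (z + s • ξ) ξ) s := by
  have h : ∀ᶠ s in 𝓝 (0 : ℝ), u (z + s • ξ) < c :=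
    (tendsto_line z ξ).eventually (hu.continuousAt.eventually_lt_const hc)
  filter_upwards [h, hu.eventually_hasDerivAt_line ξ] with s hs hd
  refine ((hd.const_sub c).log (sub_pos.2 hs).ne').neg.congr_deriv ?_
  rw [dlog]
  ring

theorem ContDiffAt.hasDerivAt_dlog_line {u : E → ℝ} {z : E} {c : ℝ}
    (hu : ContDiffAt ℝ 2 u z) (hc : u z < c) (ξ : E) :
    HasDerivAt (fun s : ℝ => dlog u c (z + s • ξ) ξ)
      (fderiv ℝ (fderiv ℝ u) z ξ ξ / (c - u z) + dlog u c z ξ ^ 2) 0 := by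
  have h1 := hu.hasDerivAt_fderiv_line ξ
  have h2 := (hu.eventually_hasDerivAt_line ξ).self_of_nhds
  have hne : c - u (z + (0 : ℝ) • ξ) ≠ 0 := by simpa using (sub_pos.2 hc).ne'
  refine (h1.div (h2.const_sub c) hne).congr_deriv ?_
  have hne' : c - u z ≠ 0 := (sub_pos.2 hc).ne'
  simp only [dlog, zero_smul, add_zero]
  field_simp
  ring

theorem hasDerivAt_norm_line {z : E} (hz : z ≠ 0) (ξ : E) :
    HasDerivAt (fun s : ℝ => ‖z + s • ξ‖) ⟪‖z‖⁻¹ • z, ξ⟫ 0 := by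
  have h := (hasDerivAt_line z ξ 0).norm_sq.sqrt (by simpa using hz)
  simp only [Real.sqrt_sq (norm_nonneg _), zero_smul, add_zero] at h
  refine h.congr_deriv ?_
  rw [real_inner_smul_left]
  field_simp

theorem hasDerivAt_norm_sq_line (z ξ : E) (s : ℝ) :
    HasDerivAt (fun s : ℝ => ‖z + s • ξ‖ ^ 2) (2 * (⟪z, ξ⟫ + s * ‖ξ‖ ^ 2)) s := by
  refine (hasDerivAt_line z ξ s).norm_sq.congr_deriv ?_
  rw [inner_add_left, real_inner_smul_left, real_inner_self_eq_norm_sq]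

/-! ### First and second order conditions for the doubled function -/

/-- The function maximized in the doubling of variables. -/
noncomputable def doubling (u : E → ℝ) (c : ℝ) (x₀ : E) (g : ℝ → ℝ) (B : ℝ) (z : E × E) : ℝ :=
  -Real.log (c - u z.1) + Real.log (c - u z.2) - g ‖z.1 - z.2‖ - B * ‖z.1 - x₀‖ ^ 2

theorem doubling_isLocalMax_line {u : E → ℝ} {c B : ℝ} {x₀ x y : E} {g : ℝ → ℝ}
    (hmax : IsLocalMax (doubling u c x₀ g B) (x, y)) (ξ η : E) :
    IsLocalMax (fun s : ℝ => -Real.log (c - u (x + s • ξ)) - -Real.log (c - u (y + s • η))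
      - g ‖x - y + s • (ξ - η)‖ - B * ‖x - x₀ + s • ξ‖ ^ 2) 0 := by
  have ht : Tendsto (fun s : ℝ => (x + s • ξ, y + s • η)) (𝓝 0) (𝓝 (x, y)) :=
    (tendsto_line x ξ).prodMk_nhds (tendsto_line y η)
  have h := ht.eventually hmax
  filter_upwards [h] with s hs
  have e1 : x + s • ξ - (y + s • η) = x - y + s • (ξ - η) := by module
  have e2 : x + s • ξ - x₀ = x - x₀ + s • ξ := by module
  simp only [doubling, e1, e2] at hs
  simp only [zero_smul, add_zero]
  linarith

theorem doubling_first_order {u : E → ℝ} {c B q : ℝ} {x₀ x y : E} {g : ℝ → ℝ}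
    (hux : ContDiffAt ℝ 2 u x) (huy : ContDiffAt ℝ 2 u y) (hcx : u x < c) (hcy : u y < c)
    (hxy : x ≠ y) (hg : HasDerivAt g q ‖x - y‖)
    (hmax : IsLocalMax (doubling u c x₀ g B) (x, y)) (ξ η : E) :
    dlog u c x ξ - dlog u c y η - q * ⟪‖x - y‖⁻¹ • (x - y), ξ - η⟫
      - B * (2 * ⟪x - x₀, ξ⟫) = 0 := by
  have h1 := (hux.eventually_hasDerivAt_log_line hcx ξ).self_of_nhds
  have h2 := (huy.eventually_hasDerivAt_log_line hcy η).self_of_nhds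
  have h3 := hasDerivAt_norm_line (sub_ne_zero.2 hxy) (ξ - η)
  have hg' : HasDerivAt g q ‖x - y + (0 : ℝ) • (ξ - η)‖ := by simpa using hg
  have h4 := (hasDerivAt_norm_sq_line (x - x₀) ξ 0).const_mul B
  have h5 := ((h1.sub h2).sub (hg'.comp 0 h3)).sub h4
  have h6 := (doubling_isLocalMax_line hmax ξ η).hasDerivAt_eq_zero h5
  simpa using h6

/-- For ξ - η parallel to x - y the distance of the two moving points is affine in s near 0, so the
penalty contributes only through g''. -/
theorem doubling_second_order {u : E → ℝ} {c B F τ : ℝ} {x₀ x y : E} {g g' : ℝ → ℝ}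
    (hux : ContDiffAt ℝ 2 u x) (huy : ContDiffAt ℝ 2 u y) (hcx : u x < c) (hcy : u y < c)
    (hxy : x ≠ y) (hg : ∀ t, HasDerivAt g (g' t) t) (hg' : HasDerivAt g' (-F) ‖x - y‖)
    (hmax : IsLocalMax (doubling u c x₀ g B) (x, y)) {ξ η : E}
    (hξη : ξ - η = τ • (‖x - y‖⁻¹ • (x - y))) :
    fderiv ℝ (fderiv ℝ u) x ξ ξ / (c - u x) + dlog u c x ξ ^ 2
      - (fderiv ℝ (fderiv ℝ u) y η η / (c - u y) + dlog u c y η ^ 2)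
      + F * τ ^ 2 - 2 * B * ‖ξ‖ ^ 2 ≤ 0 := by
  have ht : 0 < ‖x - y‖ := norm_pos_iff.2 (sub_ne_zero.2 hxy)
  have hnorm : ∀ᶠ s in 𝓝 (0 : ℝ), ‖x - y + s • (ξ - η)‖ = ‖x - y‖ + s * τ := by
    have hc : Tendsto (fun s : ℝ => ‖x - y‖ + s * τ) (𝓝 0) (𝓝 (‖x - y‖ + 0 * τ)) :=
      (by fun_prop : Continuous fun s : ℝ => ‖x - y‖ + s * τ).tendsto 0
    rw [zero_mul, add_zero] at hc
    filter_upwards [hc.eventually_const_lt ht] with s hs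
    have : x - y + s • (ξ - η) = ((‖x - y‖ + s * τ) * ‖x - y‖⁻¹) • (x - y) := by
      rw [hξη, add_mul, mul_inv_cancel₀ ht.ne', add_smul, one_smul, smul_smul, smul_smul,
        mul_assoc]
    rw [this, norm_smul, Real.norm_eq_abs, abs_of_pos (by positivity), mul_assoc,
      inv_mul_cancel₀ ht.ne', mul_one]
  have hlm := (doubling_isLocalMax_line hmax ξ η).congr (g := fun s : ℝ =>
      -Real.log (c - u (x + s • ξ)) - -Real.log (c - u (y + s • η))
      - g (‖x - y‖ + s * τ) - B * ‖x - x₀ + s • ξ‖ ^ 2)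
      (hnorm.mono fun s hs => by simp only [hs])
  have hlin : ∀ s : ℝ, HasDerivAt (fun s : ℝ => ‖x - y‖ + s * τ) τ s := fun s => by
    simpa using ((hasDerivAt_id s).mul_const τ).const_add ‖x - y‖
  have hfirst : ∀ᶠ s in 𝓝 (0 : ℝ), HasDerivAt (fun s : ℝ =>
      -Real.log (c - u (x + s • ξ)) - -Real.log (c - u (y + s • η))
      - g (‖x - y‖ + s * τ) - B * ‖x - x₀ + s • ξ‖ ^ 2)
      (dlog u c (x + s • ξ) ξ - dlog u c (y + s • η) η - g' (‖x - y‖ + s * τ) * τ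
        - B * (2 * (⟪x - x₀, ξ⟫ + s * ‖ξ‖ ^ 2))) s := by
    filter_upwards [hux.eventually_hasDerivAt_log_line hcx ξ,
      huy.eventually_hasDerivAt_log_line hcy η] with s h1 h2
    exact ((h1.sub h2).sub ((hg _).comp s (hlin s))).sub
      ((hasDerivAt_norm_sq_line (x - x₀) ξ s).const_mul B)
  have hg0 : HasDerivAt g' (-F) (‖x - y‖ + 0 * τ) := by simpa using hg'
  have hsq : HasDerivAt (fun s : ℝ => B * (2 * (⟪x - x₀, ξ⟫ + s * ‖ξ‖ ^ 2)))
      (B * (2 * ‖ξ‖ ^ 2)) 0 := by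
    simpa using ((((hasDerivAt_id (0 : ℝ)).mul_const (‖ξ‖ ^ 2)).const_add
      ⟪x - x₀, ξ⟫).const_mul 2).const_mul B
  have h := hlm.second_deriv_nonpos hfirst
    ((((hux.hasDerivAt_dlog_line hcx ξ).sub (huy.hasDerivAt_dlog_line hcy η)).sub
      ((hg0.comp 0 (hlin 0)).mul_const τ)).sub hsq)
  linarith

end Lines

/-! ### The operator at a maximum point -/

theorem quadForm_hessian {n : ℕ} (u : EuclideanSpace ℝ (Fin n) → ℝ)
    (z ξ : EuclideanSpace ℝ (Fin n)) :
    quadForm (hessian u z) ξ = fderiv ℝ (fderiv ℝ u) z ξ ξ := by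
  have hξ : ξ = ∑ i, ξ i • EuclideanSpace.single i (1 : ℝ) := by
    simpa using ((EuclideanSpace.basisFun (Fin n) ℝ).sum_repr ξ).symm
  conv_rhs => rw [hξ]
  simp only [quadForm_eq_sum, hessian, Matrix.of_apply, map_sum, map_smul,
    sum_apply, smul_apply, smul_eq_mul, Finset.mul_sum]
  rw [Finset.sum_comm]
  exact Finset.sum_congr rfl fun i _ => Finset.sum_congr rfl fun j _ => by ring

theorem lt_mpMatrix {n p : ℕ} (hpn : p ≤ n) {A : Matrix (Fin n) (Fin n) ℝ}
    (hA : A.IsHermitian) {κ K : ℝ} (hκ : 1 ≤ κ) (hK : K < κ)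
    (h : ∀ s ∈ (Finset.univ : Finset (Fin n)).powersetCard p, κ ≤ ∑ i ∈ s, hA.eigenvalues i) :
    K < mpMatrix p A := by
  have hN : ((Finset.univ : Finset (Fin n)).powersetCard p).card ≠ 0 := by
    rw [Finset.card_powersetCard, Finset.card_univ, Fintype.card_fin]
    exact (Nat.choose_pos hpn).ne'
  rw [mpMatrix, dif_pos hA]
  calc K < κ := hK
    _ ≤ κ ^ ((Finset.univ : Finset (Fin n)).powersetCard p).card := le_self_pow₀ hκ hN
    _ = ∏ s ∈ (Finset.univ : Finset (Fin n)).powersetCard p, κ := by rw [Finset.prod_const]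
    _ ≤ _ := Finset.prod_le_prod (fun _ _ => by linarith) h

/-- At an interior maximum point of the doubled function the operator exceeds `K` at the second
point, if the slope `q` of `g` is large and `g` is concave enough. -/
theorem lt_mpOperator_of_isLocalMax {n p : ℕ} (hp : 0 < p) (hpn : p ≤ n) {r L F B c κ K : ℝ}
    (hB : 0 ≤ B) (hL : 0 ≤ L) (hF : 0 ≤ F) (hκ : 1 ≤ κ) (hK : K < κ)
    (hL1 : κ ≤ 2 * F / p - 2 * p * (L * (B * r) + B))
    (hL2 : κ ≤ L ^ 2 / 8 - L * (B * r) - B - 2 * p * (L * (B * r) + B))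
    {u : EuclideanSpace ℝ (Fin n) → ℝ} {x₀ x y : EuclideanSpace ℝ (Fin n)} {g g' : ℝ → ℝ}
    (hux : ContDiffAt ℝ 2 u x) (huy : ContDiffAt ℝ 2 u y) (hcx : u x < c) (hcy : u y + 1 ≤ c)
    (hA : hessian u x ∈ closure (pCone n p)) (hH : (hessian u y).IsHermitian)
    (hxy : x ≠ y) (hxr : ‖x - x₀‖ ≤ r / 2) (hg : ∀ t, HasDerivAt g (g' t) t)
    (hg' : HasDerivAt g' (-F) ‖x - y‖) (hq1 : L / 2 ≤ g' ‖x - y‖) (hq2 : g' ‖x - y‖ ≤ L)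
    (hmax : IsLocalMax (doubling u c x₀ g B) (x, y)) : K < mpOperator p u y := by
  have hcy' : u y < c := by linarith
  set q := g' ‖x - y‖
  set e := ‖x - y‖⁻¹ • (x - y) with he
  set b := (2 * B) • (x - x₀) with hb
  have he1 : ‖e‖ = 1 := norm_smul_inv_norm (𝕜 := ℝ) (sub_ne_zero.2 hxy)
  have hq0 : 0 ≤ q := by linarith
  have hbr : ‖b‖ ≤ B * r := by
    rw [hb, norm_smul, Real.norm_of_nonneg (by positivity)]
    nlinarith
  have hr0 : 0 ≤ B * r := (norm_nonneg b).trans hbr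
  have hfo : ∀ ξ η, dlog u c x ξ - dlog u c y η - q * ⟪e, ξ - η⟫
      - B * (2 * ⟪x - x₀, ξ⟫) = 0 :=
    doubling_first_order hux huy hcx hcy' hxy (hg _) hmax
  have hdy : ∀ η, dlog u c y η = q * ⟪e, η⟫ := fun η => by
    have := hfo 0 η
    simp only [dlog, map_zero, zero_div, zero_sub, inner_neg_right, inner_zero_right] at this ⊢
    linarith
  have hdx : ∀ ξ, dlog u c x ξ = q * ⟪e, ξ⟫ + ⟪b, ξ⟫ := fun ξ => by
    have := hfo ξ ξ
    rw [hdy, sub_self, inner_zero_right] at this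
    rw [hb, real_inner_smul_left (x - x₀)]
    linarith
  have hso : ∀ (τ : ℝ) (ξ η : EuclideanSpace ℝ (Fin n)), ξ - η = τ • e →
      quadForm (hessian u x) ξ / (c - u x) + (q * ⟪e, ξ⟫ + ⟪b, ξ⟫) ^ 2
        - (quadForm (hessian u y) η / (c - u y) + (q * ⟪e, η⟫) ^ 2)
        + F * τ ^ 2 - 2 * B * ‖ξ‖ ^ 2 ≤ 0 := fun τ ξ η h => by
    rw [quadForm_hessian, quadForm_hessian, ← hdx, ← hdy]
    exact doubling_second_order hux huy hcx hcy' hxy hg hg' hmax h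
  set v := hH.eigenvectorBasis
  have hee : ⟪e, e⟫ = (1 : ℝ) := by rw [real_inner_self_eq_norm_sq, he1, one_pow]
  refine lt_mpMatrix hpn hH hκ hK fun s hs => ?_
  have key := partial_trace_lower_bound hp hpn hA (sub_pos.2 hcx) v
    (fun i => hH.eigenvalues i / (c - u y)) (Finset.mem_powersetCard.1 hs).2 he1 (B := B)
    hq0 hF hbr
    -- The three families of pairs (ξ, η): (e, 0), (v i, v i), and the reflection of v i in e^⊥ with
    -- v i, where τ = -2⟪e, v i⟫.
    (by
      have := hso 1 e 0 (by simp)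
      simpa [hee, he1, quadForm] using this)
    (fun i => by
      have := hso 0 (v i) (v i) (by simp)
      rw [quadForm_eigenvectorBasis hH, v.orthonormal.1 i] at this
      linarith)
    (fun i => by
      have hrefl : ⟪e, v i - (2 * ⟪e, v i⟫) • e⟫ = -⟪e, v i⟫ := by
        rw [inner_sub_right, real_inner_smul_right, hee]
        ring
      have hnorm : ‖v i - (2 * ⟪e, v i⟫) • e‖ ^ 2 = 1 := by
        rw [norm_sub_sq_real, real_inner_smul_right, norm_smul, he1, real_inner_comm,
          v.orthonormal.1 i]
        simp only [Real.norm_eq_abs, mul_one, sq_abs]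
        ring
      have := hso (-(2 * ⟪e, v i⟫)) (v i - (2 * ⟪e, v i⟫) • e) (v i) (by simp)
      rw [quadForm_eigenvectorBasis hH, hnorm, hrefl, mul_neg] at this
      linarith)
  rw [← Finset.sum_div] at key
  have hqβ : q * (B * r) ≤ L * (B * r) := mul_le_mul_of_nonneg_right hq2 hr0
  have hp' : (0 : ℝ) < p := by exact_mod_cast hp
  have hpq := mul_le_mul_of_nonneg_left hqβ hp'.le
  have hκS : κ ≤ (∑ i ∈ s, hH.eigenvalues i) / (c - u y) := by
    refine le_trans ?_ key
    rw [le_sub_iff_add_le, le_min_iff]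
    constructor
    · linarith
    · nlinarith
  -- Since c - u y ≥ 1 and κ > 0, the bound passes from the quotient to the eigenvalue sum.
  rw [le_div_iff₀ (by linarith)] at hκS
  nlinarith

/-! ### Choice of constants and exclusion of a positive maximum -/

theorem exists_large_slope {p : ℕ} (hp : 0 < p) {m : ℝ} (hm : 0 < m) (r B κ : ℝ) :
    ∃ L : ℝ, 0 < L ∧ 8 * m / r ≤ L ∧
      κ ≤ 2 * (L ^ 2 / (4 * m)) / p - 2 * p * (L * (B * r) + B) ∧
      κ ≤ L ^ 2 / 8 - L * (B * r) - B - 2 * p * (L * (B * r) + B) := by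
  have hp' : (0 : ℝ) < p := by exact_mod_cast hp
  have aux : ∀ a β γ : ℝ, 0 < a → ∀ᶠ L : ℝ in atTop, γ ≤ L * (a * L + β) := fun a β γ ha =>
    (tendsto_id.atTop_mul_atTop₀ (tendsto_atTop_add_const_right _ β
      (tendsto_id.const_mul_atTop ha))).eventually_ge_atTop γ
  obtain ⟨L, h1, h2, h3, h4⟩ := ((eventually_gt_atTop 0).and
    ((eventually_ge_atTop (8 * m / r)).and
    ((aux (1 / (2 * m * p)) (-(2 * p * (B * r))) (κ + 2 * p * B) (by positivity)).and
    (aux (1 / 8) (-(B * r) - 2 * p * (B * r)) (κ + B + 2 * p * B) (by norm_num))))).exists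
  refine ⟨L, h1, h2, ?_, by linarith⟩
  have : 2 * (L ^ 2 / (4 * m)) / p = 1 / (2 * m * p) * L * L := by
    field_simp
    ring
  linarith

theorem doubling_nonpos {n p : ℕ} (hp : 0 < p) (hpn : p ≤ n) {r M K κ L m t₀ : ℝ}
    (hr : 0 < r) (hκ : 1 ≤ κ) (hK : K < κ) (hL : 0 < L) (hM : 0 ≤ M)
    (hm : m = Real.log (2 * M + 1) + 1) (ht₀ : t₀ = 2 * m / L) (hLr : 8 * m / r ≤ L)
    (hL1 : κ ≤ 2 * (L ^ 2 / (4 * m)) / p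
      - 2 * p * (L * (4 * m / r ^ 2 * r) + 4 * m / r ^ 2))
    (hL2 : κ ≤ L ^ 2 / 8 - L * (4 * m / r ^ 2 * r) - 4 * m / r ^ 2
      - 2 * p * (L * (4 * m / r ^ 2 * r) + 4 * m / r ^ 2))
    {x₀ : EuclideanSpace ℝ (Fin n)} {u : EuclideanSpace ℝ (Fin n) → ℝ}
    (hu : IsPPlurisubharmonicOn p u (Metric.ball x₀ r))
    (huM : ∀ x ∈ Metric.ball x₀ r, |u x| ≤ M)
    (hle : ∀ x ∈ Metric.ball x₀ r, mpOperator p u x ≤ K)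
    {y : EuclideanSpace ℝ (Fin n)} (hy : ‖x₀ - y‖ ≤ t₀) :
    doubling u (M + 1) x₀ (fun t => L * t - L / (4 * t₀) * t ^ 2) (4 * m / r ^ 2) (x₀, y)
      ≤ 0 := by
  set B := 4 * m / r ^ 2 with hB
  set g : ℝ → ℝ := fun t => L * t - L / (4 * t₀) * t ^ 2 with hg
  have hm1 : 1 ≤ m := by
    have := Real.log_nonneg (by linarith : (1 : ℝ) ≤ 2 * M + 1)
    linarith
  have hm0 : 0 < m := by linarith
  have ht₀p : 0 < t₀ := by rw [ht₀]; positivity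
  have hB0 : 0 < B := by positivity
  -- Since r/2 + r/4 < r, both points stay in the ball.
  have ht₀r : t₀ ≤ r / 4 := by
    rw [div_le_iff₀ hr] at hLr
    rw [ht₀, div_le_iff₀ hL]
    linarith
  have hLt : L * t₀ = 2 * m := by rw [ht₀]; field_simp
  have hgfac : ∀ t, g t = L * t * (1 - t / (4 * t₀)) := fun t => by
    simp only [hg]
    field_simp
  have hg0 : ∀ t, 0 ≤ t → t ≤ t₀ → 0 ≤ g t := fun t h1 h2 => by
    rw [hgfac]
    have : t / (4 * t₀) ≤ 1 := by rw [div_le_one (by positivity)]; linarith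
    exact mul_nonneg (by positivity) (by linarith)
  by_contra! hpos
  set S : Set (EuclideanSpace ℝ (Fin n) × EuclideanSpace ℝ (Fin n)) :=
    {z | ‖z.1 - x₀‖ ≤ r / 2 ∧ ‖z.1 - z.2‖ ≤ t₀} with hS
  have hball : ∀ z ∈ S, z.1 ∈ Metric.ball x₀ r ∧ z.2 ∈ Metric.ball x₀ r := by
    rintro ⟨x, y⟩ ⟨h1, h2⟩
    simp only at h1 h2
    simp only [mem_ball_iff_norm]
    refine ⟨by linarith, ?_⟩
    have : ‖y - x₀‖ ≤ ‖y - x‖ + ‖x - x₀‖ := norm_sub_le_norm_sub_add_norm_sub y x x₀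
    rw [norm_sub_rev y x] at this
    linarith
  have hScl : IsClosed S :=
    (isClosed_le (f := fun z : EuclideanSpace ℝ (Fin n) × EuclideanSpace ℝ (Fin n) =>
      ‖z.1 - x₀‖) (by fun_prop) continuous_const).inter
      (isClosed_le (f := fun z : EuclideanSpace ℝ (Fin n) × EuclideanSpace ℝ (Fin n) =>
      ‖z.1 - z.2‖) (by fun_prop) continuous_const)
  have hScomp : IsCompact S := by
    refine ((isCompact_closedBall x₀ r).prod (isCompact_closedBall x₀ r)).of_isClosed_subset
      hScl fun z hz => ?_
    exact ⟨Metric.ball_subset_closedBall (hball z hz).1,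
      Metric.ball_subset_closedBall (hball z hz).2⟩
  have hpos' : ∀ z ∈ Metric.ball x₀ r, 1 ≤ M + 1 - u z ∧ M + 1 - u z ≤ 2 * M + 1 :=
    fun z hz => by
      have := abs_le.1 (huM z hz)
      constructor <;> linarith
  have hlog : ∀ z ∈ Metric.ball x₀ r,
      0 ≤ Real.log (M + 1 - u z) ∧ Real.log (M + 1 - u z) ≤ m - 1 := fun z hz => by
    obtain ⟨h1, h2⟩ := hpos' z hz
    have := Real.log_le_log (by linarith) h2
    exact ⟨Real.log_nonneg h1, by linarith⟩
  have hucont : ContinuousOn u (Metric.ball x₀ r) := hu.contDiffOn.continuousOn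
  have hcont : ContinuousOn (doubling u (M + 1) x₀ g B) S := by
    have hc1 : ContinuousOn (fun z : EuclideanSpace ℝ (Fin n) × EuclideanSpace ℝ (Fin n) =>
        Real.log (M + 1 - u z.1)) S :=
      (continuousOn_const.sub (hucont.comp continuousOn_fst fun z hz => (hball z hz).1)).log
        fun z hz => (zero_lt_one.trans_le (hpos' _ (hball z hz).1).1).ne'
    have hc2 : ContinuousOn (fun z : EuclideanSpace ℝ (Fin n) × EuclideanSpace ℝ (Fin n) =>
        Real.log (M + 1 - u z.2)) S :=
      (continuousOn_const.sub (hucont.comp continuousOn_snd fun z hz => (hball z hz).2)).log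
        fun z hz => (zero_lt_one.trans_le (hpos' _ (hball z hz).2).1).ne'
    have hc3 : Continuous fun z : EuclideanSpace ℝ (Fin n) × EuclideanSpace ℝ (Fin n) =>
        g ‖z.1 - z.2‖ := by simp only [hg]; fun_prop
    have hc4 : Continuous fun z : EuclideanSpace ℝ (Fin n) × EuclideanSpace ℝ (Fin n) =>
        B * ‖z.1 - x₀‖ ^ 2 := by fun_prop
    exact ((hc1.neg.add hc2).sub hc3.continuousOn).sub hc4.continuousOn
  have hyS : (x₀, y) ∈ S := ⟨by simp; positivity, hy⟩
  obtain ⟨⟨x, z⟩, hxz, hmax⟩ := hScomp.exists_isMaxOn ⟨_, hyS⟩ hcont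
  have hval : 0 < doubling u (M + 1) x₀ g B (x, z) := hpos.trans_le (hmax hyS)
  obtain ⟨hx1, hz1⟩ := hball _ hxz
  obtain ⟨hxr, hxzt⟩ := hxz
  simp only at hx1 hz1 hxr hxzt
  have hgz := hg0 _ (norm_nonneg _) hxzt
  have hlx := hlog x hx1
  have hlz := hlog z hz1
  simp only [doubling] at hval
  have hne : x ≠ z := by
    rintro rfl
    have : 0 ≤ B * ‖x - x₀‖ ^ 2 := by positivity
    linarith
  -- On either boundary piece a penalty is at least m (B(r/2)² = m, g(t₀) = 3m/2), while the
  -- logarithms differ by at most m - 1.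
  have hxr' : ‖x - x₀‖ < r / 2 := by
    refine lt_of_le_of_ne hxr fun h => ?_
    have : B * ‖x - x₀‖ ^ 2 = m := by
      rw [h, hB]
      field_simp
      ring
    linarith
  have hxzt' : ‖x - z‖ < t₀ := by
    refine lt_of_le_of_ne hxzt fun h => ?_
    have h1 : g ‖x - z‖ = 3 / 2 * m := by
      rw [h, hgfac, hLt]
      field_simp
      ring
    have : 0 ≤ B * ‖x - x₀‖ ^ 2 := by positivity
    linarith
  have hnhds : S ∈ 𝓝 (x, z) := by
    have o1 : ∀ᶠ w : EuclideanSpace ℝ (Fin n) × EuclideanSpace ℝ (Fin n) in 𝓝 (x, z),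
        ‖w.1 - x₀‖ < r / 2 :=
      (by fun_prop : Continuous fun w : EuclideanSpace ℝ (Fin n) × EuclideanSpace ℝ (Fin n) =>
        ‖w.1 - x₀‖).continuousAt.eventually_lt_const hxr'
    have o2 : ∀ᶠ w : EuclideanSpace ℝ (Fin n) × EuclideanSpace ℝ (Fin n) in 𝓝 (x, z),
        ‖w.1 - w.2‖ < t₀ :=
      (by fun_prop : Continuous fun w : EuclideanSpace ℝ (Fin n) × EuclideanSpace ℝ (Fin n) =>
        ‖w.1 - w.2‖).continuousAt.eventually_lt_const hxzt'
    filter_upwards [o1, o2] with w h1 h2 using ⟨h1.le, h2.le⟩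
  have hderiv : ∀ t, HasDerivAt g (L - L / (2 * t₀) * t) t := fun t => by
    refine (((hasDerivAt_id t).const_mul L).sub
      (((hasDerivAt_id t).pow 2).const_mul (L / (4 * t₀)))).congr_deriv ?_
    simp only [id]
    field_simp
    ring
  have hderiv2 : HasDerivAt (fun t : ℝ => L - L / (2 * t₀) * t) (-(L ^ 2 / (4 * m))) ‖x - z‖ := by
    refine (((hasDerivAt_id _).const_mul (L / (2 * t₀))).const_sub L).congr_deriv ?_
    rw [ht₀]
    field_simp
    ring
  have hslope : L / (2 * t₀) * ‖x - z‖ ≤ L / 2 := by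
    have := mul_le_mul_of_nonneg_left hxzt (by positivity : 0 ≤ L / (2 * t₀))
    refine this.trans_eq ?_
    field_simp
  refine absurd (hle z hz1) (not_le.2 ?_)
  exact lt_mpOperator_of_isLocalMax hp hpn hB0.le hL.le (by positivity) hκ hK hL1 hL2
    (hu.contDiffOn.contDiffAt (Metric.isOpen_ball.mem_nhds hx1))
    (hu.contDiffOn.contDiffAt (Metric.isOpen_ball.mem_nhds hz1))
    (by linarith [(hpos' x hx1).1]) (by linarith [(hpos' z hz1).1])
    (hu.hessian_mem x hx1) (hessian_isHermitian Metric.isOpen_ball hu.contDiffOn hz1)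
    hne hxr hderiv hderiv2 (by linarith)
    (by have : 0 ≤ L / (2 * t₀) * ‖x - z‖ := by positivity
        linarith)
    (hmax.isLocalMax hnhds)

/-! ### From the logarithm to the gradient -/

/-- Gradient bound at a point from a one-sided Lipschitz bound of `-log (c - u)`. -/
theorem norm_gradient_le_of_log {n : ℕ} {u : EuclideanSpace ℝ (Fin n) → ℝ}
    {x₀ : EuclideanSpace ℝ (Fin n)} {c L : ℝ} (hu : ContDiffAt ℝ 2 u x₀) (hc : u x₀ < c)
    (hL : 0 ≤ L)
    (h : ∀ᶠ y in 𝓝 x₀, -Real.log (c - u x₀) + Real.log (c - u y) ≤ L * ‖x₀ - y‖) :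
    ‖gradient u x₀‖ ≤ (c - u x₀) * L := by
  have hc' : 0 < c - u x₀ := sub_pos.2 hc
  have hd : ∀ ξ, -dlog u c x₀ ξ ≤ L * ‖ξ‖ := fun ξ => by
    have h1 := (hu.eventually_hasDerivAt_log_line hc ξ).self_of_nhds
    have h2 := h1.neg.hasDerivWithinAt (s := Set.Ioi 0)
    rw [hasDerivWithinAt_iff_tendsto_slope' (by simp)] at h2
    simp only [zero_smul, add_zero] at h2
    refine le_of_tendsto h2 ?_
    have h3 := ((tendsto_line x₀ ξ).mono_left
      (nhdsWithin_le_nhds (s := Set.Ioi 0))).eventually h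
    filter_upwards [h3, self_mem_nhdsWithin] with s hs hs0
    have hs0' : (0 : ℝ) < s := hs0
    rw [slope_def_field, sub_zero, div_le_iff₀ hs0']
    rw [sub_add_cancel_left, norm_neg, norm_smul, Real.norm_of_nonneg hs0'.le] at hs
    simp only [Pi.neg_apply, zero_smul, add_zero, neg_neg]
    linarith
  rw [gradient, LinearIsometryEquiv.norm_map]
  refine ContinuousLinearMap.opNorm_le_bound _ (by positivity) fun ξ => ?_
  have hbound : ∀ ξ, -fderiv ℝ u x₀ ξ ≤ (c - u x₀) * L * ‖ξ‖ := fun ξ => by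
    have := hd ξ
    rw [dlog, ← neg_div, div_le_iff₀ hc'] at this
    linarith
  have h1 := hbound ξ
  have h2 := hbound (-ξ)
  rw [map_neg, neg_neg, norm_neg] at h2
  rw [Real.norm_eq_abs, abs_le]
  constructor <;> linarith

theorem mainTheorem3 (n p : ℕ) (hp : 1 < p) (hpn : p < n) (r : ℝ) (hr : 0 < r) (M K : ℝ) :
    ∃ C : ℝ, ∀ (x₀ : EuclideanSpace ℝ (Fin n)) (u : EuclideanSpace ℝ (Fin n) → ℝ)
      (f : EuclideanSpace ℝ (Fin n) → ℝ → ℝ),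
      IsPPlurisubharmonicOn p u (Metric.ball x₀ r) →
      ContDiffOn ℝ 3 u (Metric.ball x₀ r) →
      ContDiffOn ℝ 1 u (Metric.closedBall x₀ r) →
      (∀ x ∈ Metric.ball x₀ r, |u x| ≤ M) →
      (∀ x ∈ Metric.ball x₀ r, ∀ s : ℝ, 0 ≤ f x s) →
      HasLipschitzBound f (Metric.ball x₀ r) K →
      (∀ x ∈ Metric.ball x₀ r, mpOperator p u x = f x (u x)) →
      ‖gradient u x₀‖ ≤ C := by
  rcases lt_or_ge M 0 with hM | hM
  · refine ⟨0, fun x₀ u f _ _ _ huM _ _ _ => ?_⟩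
    have := (abs_nonneg _).trans (huM x₀ (Metric.mem_ball_self hr))
    linarith
  have hp0 : 0 < p := by omega
  set m := Real.log (2 * M + 1) + 1 with hm
  have hm0 : 0 < m := by
    have := Real.log_nonneg (by linarith : (1 : ℝ) ≤ 2 * M + 1)
    linarith
  -- With κ = max K 0 + 1 ≥ 1, a product of factors at least κ is still at least κ > K.
  obtain ⟨L, hL, hLr, hL1, hL2⟩ :=
    exists_large_slope hp0 hm0 r (4 * m / r ^ 2) (max K 0 + 1)
  refine ⟨(2 * M + 1) * L, fun x₀ u f hu _ _ huM _ hf hsol => ?_⟩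
  have hx₀ := Metric.mem_ball_self (x := x₀) hr
  have hu₀ := abs_le.1 (huM x₀ hx₀)
  have ht₀ : 0 < 2 * m / L := by positivity
  have hmain : ‖gradient u x₀‖ ≤ (M + 1 - u x₀) * L := by
    refine norm_gradient_le_of_log
      (hu.contDiffOn.contDiffAt (Metric.isOpen_ball.mem_nhds hx₀)) (by linarith) hL.le ?_
    filter_upwards [Metric.closedBall_mem_nhds x₀ ht₀] with y hy
    rw [mem_closedBall_iff_norm, norm_sub_rev] at hy
    have h := doubling_nonpos hp0 hpn.le hr
      (le_add_of_nonneg_left (le_max_right K 0)) (lt_of_le_of_lt (le_max_left K 0) (lt_add_one _))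
      hL hM hm rfl hLr hL1 hL2 hu huM
      (fun x hx => by
        rw [hsol x hx]
        exact (le_abs_self _).trans (hf.bound x hx _))
      hy
    simp only [doubling, sub_self, norm_zero] at h
    have : 0 ≤ L / (4 * (2 * m / L)) * ‖x₀ - y‖ ^ 2 := by positivity
    linarith
  refine hmain.trans (mul_le_mul_of_nonneg_right ?_ hL.le)
  linarith
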